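/- **Theorem.** Every graph $G=(V,E)$ that is obtained from $K_4$ by a finite sequence of edge additions and $1$-extensions is globally rigid in $\mathbb R^2$. Here all graphs are finite and simple, and are considered up to isomorphism. An *edge addition* joins two distinct non-adjacent vertices by an edge. A *$1$-extension* picks an edge $uv$ and a vertex $w\neq u,v$, adds a new vertex $z$, and replaces the edge set $E$ by $(E\setminus\{uv\})\cup\{zu,zv,zw\}$. Let $n=|V|$ and $m=|E|$. The *edge function* of $G$ is $f_G:(\mathbb R^2)^V\cong\mathbb R^{2n}\to\mathbb R^{m}$, $f_G(\mathbf p)=(\|\mathbf p(i)-\mathbf p(j)\|^2)_{ij\in E}$, and $r(G)=\max_{\mathbf p\in\mathbb R^{2n}}\operatorname{rank}J_{f_G}(\mathbf p)$ is the maximal rank of its Jacobian. A point $\mathbf p\in\mathbb R^{2n}$ (not necessarily injective as a map $V\to\mathbb R^2$) is a *regular* embedding of $G$ if $\operatorname{rank}J_{f_G}(\mathbf p)=r(G)$. It is a *generic* embedding of $G$ if it is regular and $\mathbf y=f_G(\mathbf p)$ is a regular point of the image $I=f_G(\mathbb R^{2n})$, that is, near $\mathbf y$ the set $I$ is a smooth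 embedded submanifold of $\mathbb R^m$ of dimension $r(G)=\dim I$: there are an open neighbourhood $U$ of $\mathbf y$ and a smooth map $g:U\to\mathbb R^{m-r(G)}$ whose differential at $\mathbf y$ is surjective, such that $I\cap U=\{\mathbf z\in U: g(\mathbf z)=0\}$. The graph $G$ is *globally rigid in $\mathbb R^2$* if, for every two generic embeddings $\mathbf p,\mathbf p'$ of $G$ with $f_G(\mathbf p)=f_G(\mathbf p')$, the configurations $\mathbf p$ and $\mathbf p'$ are congruent, that is, there is an isometry $\tau$ of $\mathbb R^2$ with $\tau(\mathbf p(v))=\mathbf p'(v)$ for all $v\in V$ (in particular the sets $\mathbf p(V)$ and $\mathbf p'(V)$ are congruent). -/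

import Mathlib

open scoped ContDiff

universe u

namespace PlanarRigidity

/-- The Euclidean plane. -/
abbrev Plane : Type := EuclideanSpace ℝ (Fin 2)

section Construction

variable {V : Type u}

/-- The `1`-extension of `G`: the edge `uv` is subdivided by a new vertex `none`, which is also
joined to `w`. The new edge set is `(E \ {uv}) ∪ {zu, zv, zw}` with `z = none`. -/
def oneExtension (G : SimpleGraph V) (a b w : V) : SimpleGraph (Option V) :=
  SimpleGraph.fromEdgeSet
    ((Sym2.map some '' (G.edgeSet \ {s(a, b)})) ∪
      {s(none, some a), s(none, some b), s(none, some w)})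

/-- Graphs that can be obtained (up to isomorphism) from `K₄` by a finite sequence of edge
additions and `1`-extensions. -/
inductive BuiltFromK4 : {V : Type u} → SimpleGraph V → Prop
  | base {V : Type u} (hV : Nat.card V = 4) : BuiltFromK4 (⊤ : SimpleGraph V)
  | edgeAddition {V : Type u} {G : SimpleGraph V} (h : BuiltFromK4 G) {a b : V}
      (hab : a ≠ b) (hn : ¬ G.Adj a b) : BuiltFromK4 (G ⊔ SimpleGraph.edge a b)
  | oneExt {V : Type u} {G : SimpleGraph V} (h : BuiltFromK4 G) {a b w : V}
      (hab : G.Adj a b) (hwa : w ≠ a) (hwb : w ≠ b) : BuiltFromK4 (oneExtension G a b w)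
  | iso {V W : Type u} {G : SimpleGraph V} {H : SimpleGraph W} (h : BuiltFromK4 G)
      (e : G ≃g H) : BuiltFromK4 H

end Construction

noncomputable section

/-- `y` is a regular point of the `d`-dimensional set `S ⊆ ℝ^ι`: near `y`, the set `S` is a smooth
embedded submanifold of dimension `d`, i.e. it is the zero set of `k = |ι| - d` smooth functions
whose differentials at `y` are linearly independent. -/
def IsRegularPoint {ι : Type*} [Fintype ι] (S : Set (ι → ℝ)) (d : ℕ) (y : ι → ℝ) : Prop :=
  y ∈ S ∧ ∃ k : ℕ, k + d = Fintype.card ι ∧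
    ∃ U : Set (ι → ℝ), IsOpen U ∧ y ∈ U ∧
      ∃ g : (ι → ℝ) → (Fin k → ℝ), ContDiffOn ℝ ∞ g U ∧
        Function.Surjective (fderiv ℝ g y) ∧ S ∩ U = {z | z ∈ U ∧ g z = 0}

variable {V : Type u}

/-- The edge function `f_G`, sending `p` to the squared lengths of the edges of `G`. -/
def edgeFunction (G : SimpleGraph V) (p : V → Plane) : G.edgeSet → ℝ :=
  fun e => Sym2.lift ⟨fun i j => ‖p i - p j‖ ^ 2, fun i j => by simp only [norm_sub_rev]⟩ (e : Sym2 V)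

/-- Two configurations are congruent if an isometry of the plane maps one to the other,
point by point. -/
def IsCongruent (p p' : V → Plane) : Prop :=
  ∃ τ : Plane ≃ᵢ Plane, ∀ v, τ (p v) = p' v

variable [Fintype V]

/-- The rank at `p` of the Jacobian of the edge function. -/
def jacobianRank (G : SimpleGraph V) (p : V → Plane) : ℕ :=
  Module.finrank ℝ (LinearMap.range (fderiv ℝ (edgeFunction G) p).toLinearMap)

/-- `r(G)`, the maximal rank of the Jacobian of the edge function (the ranks are bounded by the
number of edges); it is also the dimension of the image of the edge function. -/
def maxRank (G : SimpleGraph V) : ℕ := ⨆ p : V → Plane, jacobianRank G p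

/-- Regular embeddings: the Jacobian of the edge function has maximal rank. -/
def IsRegularEmbedding (G : SimpleGraph V) (p : V → Plane) : Prop :=
  jacobianRank G p = maxRank G

open Classical in
/-- Generic embeddings: `p` is regular, and `f_G(p)` is a regular point of the image of `f_G`. -/
def IsGenericEmbedding (G : SimpleGraph V) (p : V → Plane) : Prop :=
  IsRegularEmbedding G p ∧
    IsRegularPoint (Set.range (edgeFunction G)) (maxRank G) (edgeFunction G p)

/-- Global rigidity in the plane: any two generic embeddings with the same edge lengths are
congruent. -/
def GloballyRigid (G : SimpleGraph V) : Prop :=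
  ∀ p p' : V → Plane, IsGenericEmbedding G p → IsGenericEmbedding G p' →
    edgeFunction G p = edgeFunction G p' → IsCongruent p p'

end

end PlanarRigidity

/-! Relate two generic configurations when their edge lengths agree. At a generic point the edge
function is a submersion onto its image, locally a manifold of dimension `maxRank G`, so each
configuration can follow every small motion of the other: the relation is biopen. It remains to
prove `BiopenRigid G` by induction on the construction.

The crux is a `1`-extension on `uv` with new vertex `z`. Restricting a relation to the old vertices
keeps it biopen, so only the length of `uv` has to be recovered. On a dense open set of
configurations `G - uv` is infinitesimally rigid. If `z` alone moves on one side, the old vertices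
on the other side can therefore only move by congruences. So for all `z` in an open set, the
distances from `z` to the triangle `uvw` are realised from one fixed triangle up to congruence, and
comparing quadratic polynomials makes the triangles congruent (`norm_sq_eq_of_eventually_exists`).
Degenerate positions are avoided through `IsBiopen.of_dense`. Rigidity of `G - uv` comes from
`RedundantlyRigid`, carried through the same induction. -/

namespace PlanarRigidity

open Filter Topology

/-! ### Openness of a map onto a level set, and semicontinuity of rank. -/

section SubmersionOntoLevelSet

variable {E F H : Type*} [NormedAddCommGroup E] [NormedSpace ℝ E]
  [NormedAddCommGroup F] [NormedSpace ℝ F] [FiniteDimensional ℝ F]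
  [NormedAddCommGroup H] [NormedSpace ℝ H] [FiniteDimensional ℝ H]

/-- If `f` maps a neighbourhood of `p` into the zero set of a submersion `g`, and the rank of
`f` at `p` is the dimension of this zero set, then `f` is open at `p` as a map to the zero set. -/
theorem eventually_mem_image_of_submersion [CompleteSpace E] {f : E → F} {f' : E →L[ℝ] F} {g : F → H}
    {g' : F →L[ℝ] H} {p : E} (hf : HasStrictFDerivAt f f' p) (hg : HasStrictFDerivAt g g' (f p))
    (hgs : Function.Surjective g') (hgf : ∀ᶠ x in 𝓝 p, g (f x) = 0)
    (hrank : Module.finrank ℝ H + Module.finrank ℝ f'.range = Module.finrank ℝ F)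
    {N : Set E} (hN : N ∈ 𝓝 p) : ∀ᶠ z in 𝓝 (f p), g z = 0 → z ∈ f '' N := by
  have : CompleteSpace F := FiniteDimensional.complete ℝ F
  have : CompleteSpace H := FiniteDimensional.complete ℝ H
  have hgr : g'.range = ⊤ := LinearMap.range_eq_top.2 hgs
  have hker : g'.ker.ClosedComplemented := g'.ker_closedComplemented_of_finiteDimensional_range
  have hcomp : g'.comp f' = 0 := by
    have h1 : HasFDerivAt (fun x => g (f x)) (g'.comp f') p :=
      (hg.hasFDerivAt).comp p hf.hasFDerivAt
    have h2 : HasFDerivAt (fun x => g (f x)) (0 : E →L[ℝ] H) p :=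
      (hasFDerivAt_const (0 : H) p).congr_of_eventuallyEq hgf
    exact h1.unique h2
  have hle : f'.range ≤ g'.ker := by
    rintro _ ⟨x, rfl⟩
    exact congrArg (fun l : E →L[ℝ] H => l x) hcomp
  have heq : f'.range = g'.ker := by
    refine Submodule.eq_of_le_of_finrank_eq hle ?_
    have := LinearMap.finrank_range_add_finrank_ker (g' : F →ₗ[ℝ] H)
    have h3 : Module.finrank ℝ g'.range = Module.finrank ℝ H := by rw [hgr, finrank_top]
    change Module.finrank ℝ g'.range + Module.finrank ℝ g'.ker = _ at this
    omega
  -- The chart `z ↦ (g z, π (z - f p))`: on the zero set of `g` the second coordinate alone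
  -- determines a point. In that coordinate `f` is a submersion at `p`, because `f'.range = g'.ker`.
  set e := hg.implicitToOpenPartialHomeomorphOfComplemented g g' hgr hker with he
  set π : F →L[ℝ] g'.ker := Classical.choose hker with hπ
  have hπs : ∀ x : g'.ker, π x = x := Classical.choose_spec hker
  have hh : HasStrictFDerivAt (fun x => π (f x - f p)) (π.comp f') p :=
    π.hasStrictFDerivAt.comp p (hf.sub_const (f p))
  have hsurj : (π.comp f').range = ⊤ := by
    refine LinearMap.range_eq_top.2 fun v => ?_
    have hv : (v : F) ∈ f'.range := by rw [heq]; exact v.2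
    obtain ⟨x, hx⟩ := hv
    refine ⟨x, ?_⟩
    change π (f' x) = v
    have hx' : f' x = v := hx
    rw [hx', hπs]
  have hmap := hh.map_nhds_eq_of_surj hsurj
  have hsrc : e.source ∈ 𝓝 (f p) := e.open_source.mem_nhds
    (hg.mem_implicitToOpenPartialHomeomorphOfComplemented_source hgr hker)
  have hM : {x | x ∈ N ∧ f x ∈ e.source ∧ g (f x) = 0} ∈ 𝓝 p := by
    filter_upwards [hN, hf.continuousAt hsrc, hgf] with x h1 h2 h3 using ⟨h1, h2, h3⟩
  have him := image_mem_map (m := fun x => π (f x - f p)) hM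
  rw [hmap] at him
  have hc : Tendsto (fun z => π (z - f p)) (𝓝 (f p)) (𝓝 (π (f p - f p))) :=
    Continuous.tendsto (f := fun z => π (z - f p)) (by fun_prop) (f p)
  filter_upwards [hc him, hsrc] with z hz hzs hgz
  obtain ⟨x, ⟨hx1, hx2, hx3⟩, hx4⟩ := hz
  refine ⟨x, hx1, e.injOn hx2 hzs ?_⟩
  rw [he, HasStrictFDerivAt.implicitToOpenPartialHomeomorphOfComplemented_apply,
    HasStrictFDerivAt.implicitToOpenPartialHomeomorphOfComplemented_apply, hx3, hgz]
  exact Prod.ext rfl hx4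

/-- The continuous linear maps of rank at least `n` form an open set. -/
theorem eventually_le_finrank_range {X : Type*} [TopologicalSpace X] {A : X → E →L[ℝ] F} {p : X}
    (hA : ContinuousAt A p) {n : ℕ} (hn : n ≤ Module.finrank ℝ (A p).range) :
    ∀ᶠ x in 𝓝 p, n ≤ Module.finrank ℝ (A x).range := by
  have h : ∀ B : E →L[ℝ] F, n ≤ Module.finrank ℝ B.range ↔
      (n : Cardinal) ≤ (B : E →ₗ[ℝ] F).rank := by
    intro B
    rw [LinearMap.rank, ← Module.finrank_eq_rank, Nat.cast_le]
  simp only [h] at hn ⊢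
  exact hA ((isOpen_setOfPred_nat_le_rank n).mem_nhds hn)

end SubmersionOntoLevelSet

/-! ### Stability and lifting for generic embeddings. -/

section GenericEmbeddings

variable {V : Type u}

theorem edgeFunction_eq_iff (G : SimpleGraph V) (p q : V → Plane) :
    edgeFunction G p = edgeFunction G q ↔
      ∀ i j, G.Adj i j → ‖p i - p j‖ ^ 2 = ‖q i - q j‖ ^ 2 := by
  constructor
  · intro h i j hij
    exact congrFun h ⟨s(i, j), hij⟩
  · intro h
    funext ⟨e, he⟩
    induction e with
    | _ i j => exact h i j he

variable [Fintype V]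

theorem contDiff_edgeFunction (G : SimpleGraph V) [Fintype G.edgeSet] :
    ContDiff ℝ ∞ (edgeFunction G) := by
  rw [contDiff_pi]
  rintro ⟨e, he⟩
  induction e with
  | _ i j =>
    change ContDiff ℝ ∞ fun p : V → Plane => ‖p i - p j‖ ^ 2
    exact ((contDiff_apply ℝ Plane i).sub (contDiff_apply ℝ Plane j)).norm_sq ℝ

theorem jacobianRank_le_maxRank (G : SimpleGraph V) (p : V → Plane) :
    jacobianRank G p ≤ maxRank G := by
  classical
  refine le_ciSup (f := fun p : V → Plane => jacobianRank G p) ?_ p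
  -- A bound is essential: an unbounded supremum in `ℕ` has the default value `0`.
  refine ⟨Module.finrank ℝ (G.edgeSet → ℝ), ?_⟩
  rintro _ ⟨q, rfl⟩
  exact Submodule.finrank_le _

theorem eventually_isRegularEmbedding {G : SimpleGraph V} {p : V → Plane}
    (hp : IsRegularEmbedding G p) : ∀ᶠ q in 𝓝 p, IsRegularEmbedding G q := by
  classical
  have hc : ContinuousAt (fderiv ℝ (edgeFunction G)) p :=
    ((contDiff_edgeFunction G).continuous_fderiv (by simp)).continuousAt
  filter_upwards [eventually_le_finrank_range (n := maxRank G) hc hp.ge] with q hq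
  exact le_antisymm (jacobianRank_le_maxRank G q) hq

/-- Both conditions are lower bounds on ranks of continuous derivatives, hence open; the same `U`
and `g` serve at nearby points. -/
theorem eventually_isGenericEmbedding {G : SimpleGraph V} {p : V → Plane}
    (hp : IsGenericEmbedding G p) : ∀ᶠ q in 𝓝 p, IsGenericEmbedding G q := by
  classical
  obtain ⟨hreg, -, k, hk, U, hU, hpU, g, hg, hgs, hI⟩ := hp
  have hf : ContinuousAt (edgeFunction G) p := (contDiff_edgeFunction G).continuous.continuousAt
  have hc : ContinuousAt (fderiv ℝ g) (edgeFunction G p) :=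
    (hg.continuousOn_fderiv_of_isOpen hU (by simp)).continuousAt (hU.mem_nhds hpU)
  have hs : ∀ y, Function.Surjective (fderiv ℝ g y) ↔
      k ≤ Module.finrank ℝ (fderiv ℝ g y).range := by
    intro y
    constructor
    · intro h
      rw [LinearMap.range_eq_top.2 h, finrank_top, Module.finrank_fin_fun]
    · intro h
      refine LinearMap.range_eq_top.1 (Submodule.eq_top_of_finrank_eq ?_)
      refine le_antisymm (Submodule.finrank_le _) ?_
      rwa [Module.finrank_fin_fun]
  rw [hs] at hgs
  filter_upwards [eventually_isRegularEmbedding hreg, hf (hU.mem_nhds hpU),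
    hf.eventually (eventually_le_finrank_range hc hgs)] with q h1 h2 h3
  refine ⟨h1, ⟨q, rfl⟩, k, ?_, U, hU, h2, g, hg, (hs _).2 h3, hI⟩
  convert hk

/-- The source of biopenness: values of the edge function near its value at `q` lie on the zero set
of `g`, onto which the edge function is open at `q`. Genericity of `p` plays no role. -/
theorem eventually_exists_edgeFunction_eq {G : SimpleGraph V} {p q : V → Plane}
    (hq : IsGenericEmbedding G q) (h : edgeFunction G p = edgeFunction G q)
    {N : Set (V → Plane)} (hN : N ∈ 𝓝 q) :
    ∀ᶠ p' in 𝓝 p, ∃ q' ∈ N, edgeFunction G p' = edgeFunction G q' := by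
  classical
  obtain ⟨hreg, -, k, hk, U, hU, hqU, g, hg, hgs, hI⟩ := hq
  have hfc := contDiff_edgeFunction G
  have hzero : ∀ x, edgeFunction G x ∈ U → g (edgeFunction G x) = 0 := fun x hx =>
    ((Set.ext_iff.1 hI _).1 ⟨⟨x, rfl⟩, hx⟩).2
  have key := eventually_mem_image_of_submersion
    (hfc.contDiffAt.hasStrictFDerivAt (by simp) : HasStrictFDerivAt (edgeFunction G) _ q)
    ((hg.contDiffAt (hU.mem_nhds hqU)).hasStrictFDerivAt (by simp)) hgs
    ((hfc.continuous.continuousAt.eventually_mem (hU.mem_nhds hqU)).mono hzero) ?_ hN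
  · have hp : Tendsto (edgeFunction G) (𝓝 p) (𝓝 (edgeFunction G q)) := h ▸ hfc.continuous.tendsto p
    filter_upwards [hp.eventually key, hp (hU.mem_nhds hqU)] with p' h1 h2
    obtain ⟨q', h3, h4⟩ := h1 (hzero p' h2)
    exact ⟨q', h3, h4.symm⟩
  · have hr : Module.finrank ℝ (fderiv ℝ (edgeFunction G) q).range = maxRank G := hreg
    rw [Module.finrank_fin_fun, Module.finrank_fintype_fun_eq_card, hr]
    exact hk

end GenericEmbeddings

/-! ### Inner products and triangles in the plane. -/

section PlaneGeometry

theorem plane_inner (x y : Plane) : inner ℝ x y = x 0 * y 0 + x 1 * y 1 := by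
  simp [PiLp.inner_apply, Fin.sum_univ_two]
  ring

theorem plane_norm_sq (x : Plane) : ‖x‖ ^ 2 = x 0 * x 0 + x 1 * x 1 := by
  rw [← real_inner_self_eq_norm_sq, plane_inner]

/-- The signed area spanned by two vectors of the plane. -/
def cross (x y : Plane) : ℝ := x 0 * y 1 - x 1 * y 0

/-- The rotation of the plane by a right angle. -/
def rot (x : Plane) : Plane := !₂[-x 1, x 0]

theorem inner_rot_self (x : Plane) : inner ℝ x (rot x) = 0 := by
  simp [plane_inner, rot]
  ring

theorem cross_sq (x y : Plane) :
    cross x y ^ 2 = inner ℝ x x * inner ℝ y y - inner ℝ x y ^ 2 := by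
  simp only [plane_inner, cross]
  ring

/-- Inversion of the Gram matrix of `e, f`, multiplied through by its determinant so that it also
holds for dependent vectors. -/
theorem cross_sq_mul_inner (e f x y : Plane) :
    cross e f ^ 2 * inner ℝ x y =
      inner ℝ f f * (inner ℝ x e * inner ℝ y e)
        - inner ℝ e f * (inner ℝ x e * inner ℝ y f + inner ℝ x f * inner ℝ y e)
        + inner ℝ e e * (inner ℝ x f * inner ℝ y f) := by
  simp only [plane_inner, cross]
  ring

theorem eq_zero_of_inner_eq_zero {e f x : Plane} (h : cross e f ≠ 0) (he : inner ℝ e x = 0)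
    (hf : inner ℝ f x = 0) : x = 0 := by
  have := cross_sq_mul_inner e f x x
  rw [real_inner_comm e x, real_inner_comm f x] at *
  rw [he, hf] at this
  simpa [h] using this

theorem exists_inner_eq {e f : Plane} (h : cross e f ≠ 0) (s t : ℝ) :
    ∃ x : Plane, inner ℝ x e = s ∧ inner ℝ x f = t := by
  refine ⟨!₂[(s * f 1 - t * e 1) / cross e f, (t * e 0 - s * f 0) / cross e f], ?_, ?_⟩
  · simp only [plane_inner, cross] at *
    simp
    rw [div_mul_eq_mul_div, div_mul_eq_mul_div, ← add_div, div_eq_iff h]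
    ring
  · simp only [plane_inner, cross] at *
    simp
    rw [div_mul_eq_mul_div, div_mul_eq_mul_div, ← add_div, div_eq_iff h]
    ring

theorem inner_sub_eq_norm_sq (x y z : Plane) :
    inner ℝ (x - z) (y - z) = (‖x - z‖ ^ 2 + ‖y - z‖ ^ 2 - ‖x - y‖ ^ 2) / 2 := by
  simp only [plane_norm_sq, plane_inner, PiLp.sub_apply]
  ring

/-- If, for all positions of `z` near `z₀`, the distances from `z` to the vertices of a
nondegenerate triangle `u v w` are the distances of some point to the vertices of a triangle with
fixed side lengths `a`, `b`, `c`, then `‖u - v‖ = c`. -/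
theorem norm_sq_eq_of_eventually_exists {u v w z₀ : Plane} {a b c : ℝ}
    (hne : cross (u - w) (v - w) ≠ 0)
    (h : ∀ᶠ z in 𝓝 z₀, ∃ z' u' v' w' : Plane, ‖z - u‖ ^ 2 = ‖z' - u'‖ ^ 2 ∧
      ‖z - v‖ ^ 2 = ‖z' - v'‖ ^ 2 ∧ ‖z - w‖ ^ 2 = ‖z' - w'‖ ^ 2 ∧
      ‖u' - w'‖ ^ 2 = a ∧ ‖v' - w'‖ ^ 2 = b ∧ ‖u' - v'‖ ^ 2 = c) :
    ‖u - v‖ ^ 2 = c := by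
  -- `f₁, f₂` is the basis dual to `u - w, v - w`; moving `z` along it shifts the two inner products
  -- independently.
  obtain ⟨f₁, hf₁e, hf₁f⟩ := exists_inner_eq hne 1 0
  obtain ⟨f₂, hf₂e, hf₂f⟩ := exists_inner_eq hne 0 1
  set e := u - w with he
  set f := v - w with hf
  set A := inner ℝ e e with hA
  set C := inner ℝ f f with hC
  set B := inner ℝ e f with hB
  set D := cross e f ^ 2 with hD
  have hDne : D ≠ 0 := pow_ne_zero 2 hne
  have hDeq : D = A * C - B ^ 2 := cross_sq e f
  set B' := (a + b - c) / 2 with hB'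
  set D' := a * b - B' ^ 2 with hD'
  set s₀ := inner ℝ (z₀ - w) e with hs₀
  set t₀ := inner ℝ (z₀ - w) f with ht₀
  set c₁ := (A - a) / 2 with hc₁
  set c₂ := (C - b) / 2 with hc₂
  -- Both sides compute `D * D' * ‖z - w‖ ^ 2` by the Gram formula, once in each triangle. The
  -- shifts `c₁, c₂` account for the possibly different side lengths. The extra clause is kept to
  -- exclude `D' = 0`.
  have key : ∀ᶠ r : ℝ × ℝ in 𝓝 (0, 0),
      D' * (C * (s₀ + r.1) ^ 2 - 2 * B * (s₀ + r.1) * (t₀ + r.2) + A * (t₀ + r.2) ^ 2) =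
        D * (b * (s₀ + r.1 - c₁) ^ 2 - 2 * B' * (s₀ + r.1 - c₁) * (t₀ + r.2 - c₂)
          + a * (t₀ + r.2 - c₂) ^ 2) ∧ (a = 0 → s₀ + r.1 - c₁ = 0) := by
    have hcont : Tendsto (fun r : ℝ × ℝ => z₀ + r.1 • f₁ + r.2 • f₂) (𝓝 (0, 0)) (𝓝 z₀) := by
      have : Continuous fun r : ℝ × ℝ => z₀ + r.1 • f₁ + r.2 • f₂ := by fun_prop
      simpa using this.tendsto (0, 0)
    filter_upwards [hcont.eventually h] with r hr
    obtain ⟨z', u', v', w', h1, h2, h3, h4, h5, h6⟩ := hr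
    set z := z₀ + r.1 • f₁ + r.2 • f₂ with hz
    have hzw : z - w = (z₀ - w) + r.1 • f₁ + r.2 • f₂ := by rw [hz]; abel
    have hs : inner ℝ (z - w) e = s₀ + r.1 := by
      rw [hzw, inner_add_left, inner_add_left, real_inner_smul_left, real_inner_smul_left, hf₁e,
        hf₂e]
      ring
    have ht : inner ℝ (z - w) f = t₀ + r.2 := by
      rw [hzw, inner_add_left, inner_add_left, real_inner_smul_left, real_inner_smul_left, hf₁f,
        hf₂f]
      ring
    have hs' : inner ℝ (z' - w') (u' - w') = s₀ + r.1 - c₁ := by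
      rw [← hs, he, inner_sub_eq_norm_sq, inner_sub_eq_norm_sq, hc₁, hA, he,
        real_inner_self_eq_norm_sq, h4, h1, h3]
      ring
    have ht' : inner ℝ (z' - w') (v' - w') = t₀ + r.2 - c₂ := by
      rw [← ht, hf, inner_sub_eq_norm_sq, inner_sub_eq_norm_sq, hc₂, hC, hf,
        real_inner_self_eq_norm_sq, h5, h2, h3]
      ring
    have hB'' : inner ℝ (u' - w') (v' - w') = B' := by
      rw [inner_sub_eq_norm_sq, h4, h5, h6]
    have hN := cross_sq_mul_inner e f (z - w) (z - w)
    have hN' := cross_sq_mul_inner (u' - w') (v' - w') (z' - w') (z' - w')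
    have hD'' : cross (u' - w') (v' - w') ^ 2 = D' := by
      rw [cross_sq, hB'', real_inner_self_eq_norm_sq, real_inner_self_eq_norm_sq, h4, h5]
    rw [hs, ht, real_inner_self_eq_norm_sq (z - w)] at hN
    rw [hs', ht', hB'', hD'', real_inner_self_eq_norm_sq, real_inner_self_eq_norm_sq,
      real_inner_self_eq_norm_sq, h4, h5, ← h3] at hN'
    refine ⟨by linear_combination D * hN' - D' * hN, fun ha => ?_⟩
    rw [ha] at h4
    have : u' - w' = 0 := by simpa using h4
    rw [← hs', this, inner_zero_right]
  obtain ⟨δ, hδ, hball⟩ := Metric.eventually_nhds_iff_ball.1 key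
  set ε := δ / 2 with hε
  have hε0 : 0 < ε := by positivity
  have hmem : ∀ α β : ℝ, |α| < δ → |β| < δ → (α, β) ∈ Metric.ball ((0 : ℝ), (0 : ℝ)) δ := by
    intro α β h1 h2
    simp [Prod.dist_eq, h1, h2]
  have h0 : |(0 : ℝ)| < δ := by simpa
  have h1 : |ε| < δ := by rw [abs_of_pos hε0]; linarith
  have h2 : |-ε| < δ := by rwa [abs_neg]
  -- Second differences over these six points extract the three quadratic coefficients.
  obtain ⟨k00, l0⟩ := hball _ (hmem 0 0 h0 h0)
  obtain ⟨k10, l1⟩ := hball _ (hmem ε 0 h1 h0)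
  obtain ⟨k20, -⟩ := hball _ (hmem (-ε) 0 h2 h0)
  obtain ⟨k01, -⟩ := hball _ (hmem 0 ε h0 h1)
  obtain ⟨k02, -⟩ := hball _ (hmem 0 (-ε) h0 h2)
  obtain ⟨k11, -⟩ := hball _ (hmem ε ε h1 h1)
  simp only at k00 k10 k20 k01 k02 k11 l0 l1
  have hε2 : ε ^ 2 ≠ 0 := by positivity
  have hCb : D' * C = D * b := by
    refine mul_right_cancel₀ hε2 ?_
    linear_combination (k10 + k20 - 2 * k00) / 2
  have hAa : D' * A = D * a := by
    refine mul_right_cancel₀ hε2 ?_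
    linear_combination (k01 + k02 - 2 * k00) / 2
  have hBB : D' * B = D * B' := by
    refine mul_right_cancel₀ hε2 ?_
    linear_combination -(k11 - k10 - k01 + k00) / 2
  have hD'ne : D' ≠ 0 := by
    intro h
    rw [h, zero_mul] at hAa
    have ha : a = 0 := by simpa [hDne] using hAa.symm
    have := l0 ha
    have := l1 ha
    linarith
  -- The Gram data of the triangles are proportional with ratio `D / D'`. Determinants scale by its
  -- square, so the ratio is `1`.
  have hDD : D' = D := by
    refine mul_right_cancel₀ (mul_ne_zero hD'ne hDne) ?_
    linear_combination D' ^ 2 * hDeq + (D' * A) * hCb + (D * b) * hAa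
      - (D' * B + D * B') * hBB
  rw [hDD] at hCb hAa hBB
  have hCb := mul_left_cancel₀ hDne hCb
  have hAa := mul_left_cancel₀ hDne hAa
  have hBB := mul_left_cancel₀ hDne hBB
  have := inner_sub_eq_norm_sq u v w
  have hA1 : A = ‖u - w‖ ^ 2 := real_inner_self_eq_norm_sq _
  have hC1 : C = ‖v - w‖ ^ 2 := real_inner_self_eq_norm_sq _
  change B = _ at this
  linarith

end PlaneGeometry

/-! ### Injectivity in affine families of linear maps. -/

section InjectiveFamilies

variable {X Y Z : Type*}
  [NormedAddCommGroup Y] [NormedSpace ℝ Y]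
  [NormedAddCommGroup Z] [NormedSpace ℝ Z] [FiniteDimensional ℝ Z]

theorem isOpen_setOf_injective [TopologicalSpace X] {A : X → Z →ₗ[ℝ] Y} (hA : ∀ z, Continuous fun p => A p z) :
    IsOpen {p | Function.Injective (A p)} := by
  have hc : Continuous fun p => LinearMap.toContinuousLinearMap (A p) :=
    continuous_clm_apply.2 hA
  exact ContinuousLinearMap.isOpen_injective.preimage hc

/-- On the line from an injective parameter `p₀` towards `p`, a left inverse `B` of `A p₀` turns
failure of injectivity at `s` into the eigenvalue `-s⁻¹` of a fixed endomorphism, so only finitely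
many `s` are bad. -/
theorem dense_setOf_injective [NormedAddCommGroup X] [NormedSpace ℝ X] {A : X → Z →ₗ[ℝ] Y}
    (hA : ∀ p q (s : ℝ), A (p + s • (q - p)) = A p + s • (A q - A p))
    (hne : ∃ p, Function.Injective (A p)) : Dense {p | Function.Injective (A p)} := by
  obtain ⟨p₀, hp₀⟩ := hne
  obtain ⟨B, hB⟩ := (A p₀).exists_leftInverse_of_injective (LinearMap.ker_eq_bot.2 hp₀)
  intro p
  set C : Module.End ℝ Z := B ∘ₗ (A p - A p₀) with hC
  have hfin : {s : ℝ | ¬ Function.Injective (A (p₀ + s • (p - p₀)))}.Finite := by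
    refine (C.finite_hasEigenvalue.preimage
      (f := fun s : ℝ => -s⁻¹) ?_).subset ?_
    -- Since `0⁻¹ = 0`, the map `s ↦ -s⁻¹` is injective on all of `ℝ`.
    · intro s _ t _ hst
      simpa using hst
    · intro s hs
      simp only [Set.mem_ofPred_eq, ← LinearMap.ker_eq_bot, Submodule.eq_bot_iff, not_forall,
        LinearMap.mem_ker] at hs
      obtain ⟨x, hx, hx0⟩ := hs
      rw [hA, LinearMap.add_apply, LinearMap.smul_apply] at hx
      have h1 : x + s • C x = 0 := by
        have h2 := congrArg B hx
        rw [map_add, map_smul, map_zero] at h2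
        have h3 : B (A p₀ x) = x := LinearMap.congr_fun hB x
        rwa [h3] at h2
      have hs0 : s ≠ 0 := by
        rintro rfl
        simp [hx0] at h1
      refine Module.End.hasEigenvalue_of_hasEigenvector (x := x) ⟨?_, hx0⟩
      rw [Module.End.mem_eigenspace_iff]
      have h4 : s • C x = -x := by rw [eq_neg_iff_add_eq_zero, add_comm]; exact h1
      rw [neg_smul, ← smul_neg, ← h4, smul_smul, inv_mul_cancel₀ hs0, one_smul]
  have hev : ∀ᶠ s in 𝓝[≠] (1 : ℝ), Function.Injective (A (p₀ + s • (p - p₀))) := by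
    have h1 := (hfin.subset (Set.sdiff_subset (t := {1}))).isClosed.isOpen_compl.mem_nhds
      (x := (1 : ℝ)) (by simp)
    filter_upwards [mem_nhdsWithin_of_mem_nhds h1, self_mem_nhdsWithin] with s hs hs1
    by_contra h
    exact hs ⟨h, hs1⟩
  have htend : Tendsto (fun s : ℝ => p₀ + s • (p - p₀)) (𝓝[≠] 1) (𝓝 p) := by
    have : Continuous fun s : ℝ => p₀ + s • (p - p₀) := by fun_prop
    simpa using (this.tendsto 1).mono_left nhdsWithin_le_nhds
  exact mem_closure_of_tendsto htend hev

end InjectiveFamilies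

/-! ### Infinitesimal rigidity with pinned vertices. -/

section InfinitesimalRigidity

variable {V : Type u}

/-- Infinitesimal motions of the framework `(G, p)`. -/
def IsMotion (G : SimpleGraph V) (p x : V → Plane) : Prop :=
  ∀ i j, G.Adj i j → inner ℝ (p i - p j) (x i - x j) = 0

open Classical in
/-- The rigidity map of `(G, p)`, together with the displacement of `a` and the first coordinate
of the displacement of `b`. -/
noncomputable def pinnedMap (G : SimpleGraph V) (a b : V) (p : V → Plane) :
    (V → Plane) →ₗ[ℝ] (V → V → ℝ) × Plane × ℝ where
  toFun x := (fun i j => if G.Adj i j then inner ℝ (p i - p j) (x i - x j) else 0, x a, x b 0)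
  map_add' x y := by
    refine Prod.ext ?_ rfl
    funext i j
    by_cases h : G.Adj i j
    · simp only [Pi.add_apply, h, if_true, Prod.fst_add, add_sub_add_comm, inner_add_right]
    · simp [h]
  map_smul' c x := by
    refine Prod.ext ?_ rfl
    funext i j
    by_cases h : G.Adj i j
    · simp [h, ← smul_sub, real_inner_smul_right]
    · simp [h]

theorem pinnedMap_injective_iff {G : SimpleGraph V} {a b : V} {p : V → Plane} :
    Function.Injective (pinnedMap G a b p) ↔
      ∀ x, IsMotion G p x → x a = 0 → x b 0 = 0 → x = 0 := by
  rw [← LinearMap.ker_eq_bot, Submodule.eq_bot_iff]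
  refine forall_congr' fun x => ?_
  rw [LinearMap.mem_ker]
  constructor
  · intro h h1 h2 h3
    refine h (Prod.ext ?_ (Prod.ext h2 h3))
    funext i j
    by_cases hij : G.Adj i j
    · simpa [pinnedMap, hij] using h1 i j hij
    · simp [pinnedMap, hij]
  · intro h h1
    refine h ?_ (congrArg (fun y => y.2.1) h1) (congrArg (fun y => y.2.2) h1)
    intro i j hij
    simpa [pinnedMap, hij] using congrFun (congrFun (congrArg Prod.fst h1) i) j

/-- Generic infinitesimal rigidity: some framework of `G` has no infinitesimal motion fixing
`a` and the first coordinate of `b`. -/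
def GenericallyRigid (G : SimpleGraph V) : Prop :=
  ∃ a b : V, a ≠ b ∧ ∃ p, Function.Injective (pinnedMap G a b p)

theorem isOpen_setOf_pinnedMap_injective [Fintype V] (G : SimpleGraph V) (a b : V) :
    IsOpen {p | Function.Injective (pinnedMap G a b p)} := by
  refine isOpen_setOf_injective fun x => ?_
  refine Continuous.prodMk ?_ continuous_const
  refine continuous_pi fun i => continuous_pi fun j => ?_
  by_cases h : G.Adj i j
  · simp only [h, if_true]
    fun_prop
  · simp only [h, if_false]
    fun_prop

theorem dense_setOf_pinnedMap_injective [Fintype V] {G : SimpleGraph V} {a b : V}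
    (h : ∃ p, Function.Injective (pinnedMap G a b p)) :
    Dense {p | Function.Injective (pinnedMap G a b p)} := by
  refine dense_setOf_injective (fun p q s => ?_) h
  refine LinearMap.ext fun x => Prod.ext ?_ ?_
  · funext i j
    by_cases h : G.Adj i j
    · have : p i + s • (q i - p i) - (p j + s • (q j - p j))
          = (p i - p j) + s • ((q i - q j) - (p i - p j)) := by
        module
      simp only [pinnedMap, LinearMap.coe_mk, AddHom.coe_mk, h, if_true, LinearMap.add_apply,
        LinearMap.smul_apply, LinearMap.sub_apply, Prod.fst_add, Prod.smul_fst, Prod.fst_sub,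
        Pi.add_apply, Pi.smul_apply, Pi.sub_apply, smul_eq_mul]
      rw [this, inner_add_left, real_inner_smul_left, inner_sub_left (q i - q j)]
    · simp [pinnedMap, h]
  · simp [pinnedMap]

/-- The linear map whose injectivity says that `p u`, `p v`, `p w` are not collinear. -/
def triangleMap (u v w : V) (p : V → Plane) : ℝ × ℝ →ₗ[ℝ] Plane where
  toFun r := r.1 • (p u - p w) + r.2 • (p v - p w)
  map_add' r s := by simp only [Prod.fst_add, Prod.snd_add, add_smul]; abel
  map_smul' c r := by simp [mul_smul]

theorem triangleMap_injective_iff {u v w : V} {p : V → Plane} :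
    Function.Injective (triangleMap u v w p) ↔ cross (p u - p w) (p v - p w) ≠ 0 := by
  set e := p u - p w with he
  set f := p v - p w with hf
  have happ : ∀ r, triangleMap u v w p r = r.1 • e + r.2 • f := fun r => rfl
  rw [← LinearMap.ker_eq_bot, Submodule.eq_bot_iff]
  constructor
  · intro h h0
    have key : ∀ k : Fin 2, e k = 0 ∧ f k = 0 := by
      intro k
      have h1 := h (f k, -e k) (by
        rw [LinearMap.mem_ker, happ]
        ext l
        simp only [cross] at h0
        fin_cases k <;> fin_cases l <;> simp <;> linarith)
      simpa [and_comm] using h1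
    have h2 := h (1, 0) (by
      rw [LinearMap.mem_ker, happ]
      ext l
      simp [(key l).1])
    simp at h2
  · intro h r hr
    rw [LinearMap.mem_ker, happ] at hr
    have h0 := congrArg (fun x : Plane => x 0) hr
    have h1 := congrArg (fun x : Plane => x 1) hr
    simp at h0 h1
    refine Prod.ext (mul_right_cancel₀ h ?_) (mul_right_cancel₀ h ?_)
    · simp only [cross, Prod.fst_zero]
      linear_combination f 1 * h0 - f 0 * h1
    · simp only [cross, Prod.snd_zero]
      linear_combination e 0 * h1 - e 1 * h0

theorem isOpen_setOf_cross_ne_zero (u v w : V) :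
    IsOpen {p : V → Plane | cross (p u - p w) (p v - p w) ≠ 0} := by
  refine isOpen_ne_fun ?_ continuous_const
  simp only [cross]
  fun_prop

theorem dense_setOf_cross_ne_zero [Fintype V] {u v w : V} (huv : u ≠ v) (hwu : w ≠ u)
    (hwv : w ≠ v) : Dense {p : V → Plane | cross (p u - p w) (p v - p w) ≠ 0} := by
  classical
  simp only [← triangleMap_injective_iff]
  refine dense_setOf_injective (fun p q s => ?_) ?_
  · refine LinearMap.ext fun r => ?_
    simp only [triangleMap, LinearMap.coe_mk, AddHom.coe_mk, LinearMap.add_apply,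
      LinearMap.smul_apply, LinearMap.sub_apply, Pi.add_apply, Pi.smul_apply, Pi.sub_apply]
    module
  · refine ⟨fun i => if i = u then !₂[1, 0] else if i = v then !₂[0, 1] else 0, ?_⟩
    rw [triangleMap_injective_iff]
    simp [cross, huv.symm, hwu, hwv]

theorem GenericallyRigid.mono {G H : SimpleGraph V} (h : GenericallyRigid G) (hle : G ≤ H) :
    GenericallyRigid H := by
  obtain ⟨a, b, hab, p, hp⟩ := h
  refine ⟨a, b, hab, p, ?_⟩
  rw [pinnedMap_injective_iff] at hp ⊢
  exact fun x hx => hp x fun i j hij => hx i j (hle hij)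

theorem GenericallyRigid.iso {W : Type u} {G : SimpleGraph V} {H : SimpleGraph W}
    (h : GenericallyRigid G) (e : G ≃g H) : GenericallyRigid H := by
  obtain ⟨a, b, hab, p, hp⟩ := h
  refine ⟨e a, e b, fun h => hab (e.injective h), p ∘ e.symm, ?_⟩
  rw [pinnedMap_injective_iff] at hp ⊢
  intro x hx ha hb
  have h0 := hp (x ∘ e) (fun i j hij => ?_) ha hb
  · funext i
    simpa using congrFun h0 (e.symm i)
  · simpa using hx (e i) (e j) (e.map_adj_iff.2 hij)

/-- Subtracting a translation and a suitable infinitesimal rotation makes the motion satisfy the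
pins, hence vanish. -/
theorem IsMotion.exists_eq_rot {G : SimpleGraph V} {a b : V} (hab : a ≠ b) {p : V → Plane}
    (hp : Function.Injective (pinnedMap G a b p)) {x : V → Plane} (hx : IsMotion G p x) :
    ∃ s : ℝ, ∀ i j, x i - x j = s • rot (p i - p j) := by
  classical
  rw [pinnedMap_injective_iff] at hp
  have hrot : ∀ y z : Plane, rot (y - z) = rot y - rot z := by
    intro y z
    ext k
    fin_cases k <;> simp [rot]
    ring
  -- Otherwise the rotation about `p a` respects the pins, so it vanishes and all points coincide.
  -- Then every displacement is a motion, including a vertical one of `b` alone.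
  have hb : (p b - p a) 1 ≠ 0 := by
    intro h0
    have h1 := hp (fun i => rot (p i - p a)) (fun i j _ => ?_) ?_ ?_
    · have h2 : ∀ i, p i = p a := by
        intro i
        have h3 := congrFun h1 i
        have h4 := congrArg (fun x : Plane => x 0) h3
        have h5 := congrArg (fun x : Plane => x 1) h3
        simp [rot] at h4 h5
        ext k
        fin_cases k
        · simp; linarith
        · simp; linarith
      have h6 := congrFun (hp (Pi.single b !₂[0, 1]) (fun i j _ => ?_) ?_ ?_) b
      · have := congrArg (fun x : Plane => x 1) h6
        simp at this
      · simp [h2]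
      · simp [hab]
      · simp
    · dsimp only
      rw [← hrot, sub_sub_sub_cancel_right, inner_rot_self]
    · ext k
      fin_cases k <;> simp [rot]
    · simp at h0
      simp [rot]
      linarith
  have hrot' : ∀ i j, rot (p i - p j) = rot (p i - p a) - rot (p j - p a) := fun i j => by
    rw [← hrot, sub_sub_sub_cancel_right]
  set s := -(x b - x a) 0 / (p b - p a) 1 with hs
  have h := hp (fun i => x i - x a - s • rot (p i - p a)) (fun i j hij => ?_) ?_ ?_
  · refine ⟨s, fun i j => ?_⟩
    have hi := congrFun h i
    have hj := congrFun h j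
    simp only [Pi.zero_apply, sub_eq_zero] at hi hj
    rw [hrot', smul_sub, ← hi, ← hj]
    abel
  · have : x i - x a - s • rot (p i - p a) - (x j - x a - s • rot (p j - p a))
        = (x i - x j) - s • rot (p i - p j) := by
      rw [hrot' i j, smul_sub]
      abel
    dsimp only
    rw [this, inner_sub_right, hx i j hij, real_inner_smul_right, inner_rot_self]
    ring
  · ext k
    fin_cases k <;> simp [rot]
  · simp only [PiLp.sub_apply, PiLp.smul_apply, smul_eq_mul, rot] at hs hb ⊢
    simp only [hs]
    simp
    field_simp
    ring

/-- Averaging trick: if `q` and `q'` have equal edge lengths, `q' - q` is an infinitesimal motion of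
the midpoint `(q' + q) / 2`, which is still rigid when `q'` is near `q`. Being a rotation there up
to translation, it changes no distance. -/
theorem eventually_norm_sq_eq_of_pinnedMap_injective [Fintype V] {G : SimpleGraph V} {a b : V}
    (hab : a ≠ b) {q : V → Plane} (hq : Function.Injective (pinnedMap G a b q)) :
    ∀ᶠ q' in 𝓝 q, (∀ i j, G.Adj i j → ‖q' i - q' j‖ ^ 2 = ‖q i - q j‖ ^ 2) →
      ∀ i j, ‖q' i - q' j‖ ^ 2 = ‖q i - q j‖ ^ 2 := by
  have hc : Tendsto (fun q' : V → Plane => (2⁻¹ : ℝ) • (q' + q)) (𝓝 q) (𝓝 q) := by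
    have h1 : Continuous fun q' : V → Plane => (2⁻¹ : ℝ) • (q' + q) := by fun_prop
    have h2 := h1.tendsto q
    rwa [← two_smul ℝ q, smul_smul, inv_mul_cancel₀ two_ne_zero, one_smul] at h2
  filter_upwards [hc.eventually ((isOpen_setOf_pinnedMap_injective G a b).mem_nhds hq)]
    with q' hm hlen
  have hid : ∀ i j, inner ℝ (((2⁻¹ : ℝ) • (q' + q)) i - ((2⁻¹ : ℝ) • (q' + q)) j)
      ((q' - q) i - (q' - q) j) = (‖q' i - q' j‖ ^ 2 - ‖q i - q j‖ ^ 2) / 2 := by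
    intro i j
    simp [plane_inner, plane_norm_sq]
    ring
  obtain ⟨s, hs⟩ := IsMotion.exists_eq_rot hab hm (x := q' - q) fun i j hij => by
    rw [hid, hlen i j hij]
    ring
  intro i j
  have h1 := hid i j
  rw [hs, real_inner_smul_right, inner_rot_self] at h1
  linarith

end InfinitesimalRigidity

/-! ### Generic and redundant rigidity under extensions. -/

section Extensions

variable {V : Type u}

theorem oneExtension_adj_some_some {G : SimpleGraph V} {a b w i j : V} :
    (oneExtension G a b w).Adj (some i) (some j) ↔ G.Adj i j ∧ s(i, j) ≠ s(a, b) := by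
  have hinj : Function.Injective (Sym2.map (some : V → Option V)) :=
    Sym2.map.injective (Option.some_injective V)
  have h : (s(some i, some j) : Sym2 (Option V)) = Sym2.map some s(i, j) := rfl
  rw [oneExtension, SimpleGraph.fromEdgeSet_adj, Set.mem_union, h, hinj.mem_set_image]
  simp only [Set.mem_sdiff, SimpleGraph.mem_edgeSet, Set.mem_singleton_iff, Set.mem_insert_iff,
    Sym2.map_mk, Sym2.eq_iff, reduceCtorEq, false_and, and_false, or_false, ne_eq, Option.some.injEq]
  exact ⟨fun h => h.1, fun h => ⟨h, h.1.ne⟩⟩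

theorem oneExtension_adj_none_some {G : SimpleGraph V} {a b w i : V} :
    (oneExtension G a b w).Adj none (some i) ↔ i = a ∨ i = b ∨ i = w := by
  have h : (s(none, some i) : Sym2 (Option V)) ∉ Sym2.map some '' (G.edgeSet \ {s(a, b)}) := by
    rintro ⟨e, -, he⟩
    have h1 : (none : Option V) ∈ Sym2.map some e := he ▸ Sym2.mem_mk_left _ _
    simp at h1
  rw [oneExtension, SimpleGraph.fromEdgeSet_adj, Set.mem_union]
  simp [h]

theorem exists_pinnedMap_injective_and_cross_ne_zero [Finite V] {G : SimpleGraph V} {a b : V}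
    (hG : ∃ p, Function.Injective (pinnedMap G a b p)) {u v w : V} (huv : u ≠ v) (hwu : w ≠ u)
    (hwv : w ≠ v) :
    ∃ p, Function.Injective (pinnedMap G a b p) ∧ cross (p u - p w) (p v - p w) ≠ 0 := by
  have := Fintype.ofFinite V
  exact ((dense_setOf_pinnedMap_injective hG).inter_of_isOpen_left
    (dense_setOf_cross_ne_zero huv hwu hwv) (isOpen_setOf_pinnedMap_injective G a b)).nonempty

theorem genericallyRigid_of_pinnedMap_injective {G : SimpleGraph V} {H : SimpleGraph (Option V)}
    {a b : V} (hab : a ≠ b) {p : V → Plane} (hp : Function.Injective (pinnedMap G a b p)) (z : Plane)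
    (h₁ : ∀ x, IsMotion H (fun i => i.elim z p) x → IsMotion G p (fun i => x (some i)))
    (h₂ : ∀ x, IsMotion H (fun i => i.elim z p) x → (∀ i, x (some i) = 0) → x none = 0) :
    GenericallyRigid H := by
  refine ⟨some a, some b, by simpa, fun i => i.elim z p, ?_⟩
  rw [pinnedMap_injective_iff] at hp ⊢
  intro x hx ha hb
  have h : ∀ i, x (some i) = 0 := congrFun (hp _ (h₁ x hx) ha hb)
  funext i
  cases i with
  | none => exact h₂ x hx h
  | some i => exact h i

/-- Joining a new vertex to two vertices preserves generic rigidity. -/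
theorem GenericallyRigid.zeroExtension [Finite V] {G : SimpleGraph V} {H : SimpleGraph (Option V)}
    (hG : GenericallyRigid G) {u v w : V} (huv : u ≠ v) (hwu : w ≠ u) (hwv : w ≠ v)
    (hGH : ∀ i j, G.Adj i j → H.Adj (some i) (some j)) (hu : H.Adj none (some u))
    (hv : H.Adj none (some v)) : GenericallyRigid H := by
  obtain ⟨a, b, hab, hp⟩ := hG
  obtain ⟨p, hp, hne⟩ := exists_pinnedMap_injective_and_cross_ne_zero hp huv hwu hwv
  -- Placed at `p w`, the new vertex sees `p u` and `p v` in independent directions.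
  refine genericallyRigid_of_pinnedMap_injective hab hp (p w)
    (fun x hx i j hij => hx _ _ (hGH i j hij)) fun x hx h => ?_
  have h1 := hx _ _ hu
  have h2 := hx _ _ hv
  simp only [h, sub_zero, Option.elim] at h1 h2
  refine eq_zero_of_inner_eq_zero hne ?_ ?_
  · rw [← neg_sub, inner_neg_left, h1, neg_zero]
  · rw [← neg_sub, inner_neg_left, h2, neg_zero]

/-- Subdividing an edge, and joining the new vertex to a third vertex, preserves generic
rigidity. -/
theorem GenericallyRigid.oneExtension [Finite V] {G : SimpleGraph V} {H : SimpleGraph (Option V)}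
    (hG : GenericallyRigid G) {u v w : V} (huv : u ≠ v) (hwu : w ≠ u) (hwv : w ≠ v)
    (hGH : ∀ i j, G.Adj i j → s(i, j) ≠ s(u, v) → H.Adj (some i) (some j))
    (hu : H.Adj none (some u)) (hv : H.Adj none (some v)) (hw : H.Adj none (some w)) :
    GenericallyRigid H := by
  obtain ⟨a, b, hab, hp⟩ := hG
  obtain ⟨p, hp, hne⟩ := exists_pinnedMap_injective_and_cross_ne_zero hp huv hwu hwv
  -- With the new vertex at the midpoint of `uv`, its edges to `u` and `v` together imply the
  -- constraint of the deleted edge `uv`.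
  refine genericallyRigid_of_pinnedMap_injective hab hp ((2⁻¹ : ℝ) • (p u + p v))
    (fun x hx => ?_) fun x hx h => ?_
  · have h1 := hx _ _ hu
    have h2 := hx _ _ hv
    simp only [Option.elim] at h1 h2
    have h3 : inner ℝ (p u - p v) (x (some u) - x (some v)) = 0 := by
      simp [plane_inner] at h1 h2 ⊢
      linarith
    intro i j hij
    by_cases hs : s(i, j) = s(u, v)
    · rcases Sym2.eq_iff.1 hs with ⟨rfl, rfl⟩ | ⟨rfl, rfl⟩
      · exact h3
      · rw [← neg_sub (p j), ← neg_sub (x (some j)), inner_neg_neg, h3]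
    · exact hx _ _ (hGH i j hij hs)
  · have h1 := hx _ _ hu
    have h2 := hx _ _ hw
    simp only [h, sub_zero, Option.elim] at h1 h2
    refine eq_zero_of_inner_eq_zero hne ?_ ?_
    · simp [plane_inner] at h1 h2 ⊢
      linarith
    · simp [plane_inner] at h1 h2 ⊢
      linarith

/-- Generic rigidity after the removal of any edge. -/
def RedundantlyRigid (G : SimpleGraph V) : Prop :=
  ∀ i j, G.Adj i j → GenericallyRigid (G.deleteEdges {s(i, j)})

/-- If the removed edge lies outside `G`, then `G` minus any one of its edges survives; hence the
need for an edge. -/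
theorem RedundantlyRigid.mono {G H : SimpleGraph V} (hG : RedundantlyRigid G)
    (hne : ∃ i j, G.Adj i j) (hle : G ≤ H) : RedundantlyRigid H := by
  obtain ⟨k, l, hkl⟩ := hne
  intro i j hij
  by_cases h : G.Adj i j
  · exact (hG i j h).mono (SimpleGraph.deleteEdges_mono hle)
  · refine (hG k l hkl).mono fun x y hxy => ?_
    rw [SimpleGraph.deleteEdges_adj] at hxy ⊢
    refine ⟨hle hxy.1, fun he => h ?_⟩
    rw [Set.mem_singleton_iff] at he
    have := hxy.1
    rwa [← SimpleGraph.mem_edgeSet, he, SimpleGraph.mem_edgeSet] at this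

theorem RedundantlyRigid.iso {W : Type u} {G : SimpleGraph V} {H : SimpleGraph W}
    (hG : RedundantlyRigid G) (e : G ≃g H) : RedundantlyRigid H := by
  intro i j hij
  refine (hG (e.symm i) (e.symm j) (e.symm.map_adj_iff.2 hij)).iso ⟨e.toEquiv, ?_⟩
  intro x y
  simp only [SimpleGraph.deleteEdges_adj, Set.mem_singleton_iff, Sym2.eq_iff]
  have h : ∀ x i, e x = i ↔ x = e.symm i := fun x i =>
    ⟨fun h => by simp [← h], fun h => by simp [h]⟩
  have h1 : H.Adj (e x) (e y) ↔ G.Adj x y := e.map_adj_iff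
  simpa [h] using fun _ _ => h1

theorem redundantlyRigid_top (hV : Nat.card V = 4) : RedundantlyRigid (⊤ : SimpleGraph V) := by
  classical
  have : Finite V := Nat.finite_of_card_ne_zero (by omega)
  have := Fintype.ofFinite V
  rw [Nat.card_eq_fintype_card] at hV
  intro c d hcd
  have hcard : 1 < (({c, d} : Finset V)ᶜ).card := by
    rw [Finset.card_compl, hV, Finset.card_pair hcd]
    norm_num
  obtain ⟨a, ha, b, hb, hab⟩ := Finset.one_lt_card.1 hcard
  simp only [Finset.mem_compl, Finset.mem_insert, Finset.mem_singleton, not_or] at ha hb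
  have hadj : ∀ i j, i ≠ j → i ≠ c → i ≠ d →
      ((⊤ : SimpleGraph V).deleteEdges {s(c, d)}).Adj i j := by
    intro i j hij h1 h2
    rw [SimpleGraph.deleteEdges_adj]
    refine ⟨hij, ?_⟩
    rw [Set.mem_singleton_iff, Sym2.eq_iff]
    tauto
  -- Both ends `c, d` of the removed edge sit at the same point, each fixed by its edges to `a` and
  -- `b`.
  refine ⟨a, b, hab, fun i => if i = a then 0 else if i = b then !₂[0, 1] else !₂[1, 0], ?_⟩
  rw [pinnedMap_injective_iff]
  intro x hx hxa hxb
  have hb0 : x b = 0 := by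
    have h1 := hx a b (hadj a b hab ha.1 ha.2)
    simp [hxa, hab.symm, plane_inner] at h1
    ext k
    fin_cases k
    · simpa using hxb
    · simpa using h1
  funext i
  by_cases hia : i = a
  · rw [hia, hxa]; rfl
  by_cases hib : i = b
  · rw [hib, hb0]; rfl
  have h1 := hx a i (hadj a i (Ne.symm hia) ha.1 ha.2)
  have h2 := hx b i (hadj b i (Ne.symm hib) hb.1 hb.2)
  simp [hxa, hb0, hia, hib, hab.symm, plane_inner] at h1 h2
  ext k
  fin_cases k
  · simpa using h1
  · simp; linarith

/-- Deleting a new edge leaves `G - uv` with a vertex joined to two others; deleting an old edge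
`ij` leaves a `1`-extension of `G - ij`. -/
theorem RedundantlyRigid.oneExtension [Finite V] {G : SimpleGraph V} (hG : RedundantlyRigid G)
    {u v w : V} (huv : G.Adj u v) (hwu : w ≠ u) (hwv : w ≠ v) :
    RedundantlyRigid (oneExtension G u v w) := by
  have hsome : ∀ i, (PlanarRigidity.oneExtension G u v w).Adj none (some i) →
      GenericallyRigid ((PlanarRigidity.oneExtension G u v w).deleteEdges {s(none, some i)}) := by
    intro i hi
    rw [oneExtension_adj_none_some] at hi
    have h1 : ∀ k l, (G.deleteEdges {s(u, v)}).Adj k l →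
        ((PlanarRigidity.oneExtension G u v w).deleteEdges {s(none, some i)}).Adj (some k)
          (some l) := by
      intro k l hkl
      rw [SimpleGraph.deleteEdges_adj] at hkl
      rw [SimpleGraph.deleteEdges_adj, oneExtension_adj_some_some]
      exact ⟨hkl, by simp⟩
    have h2 : ∀ k, k ≠ i → (k = u ∨ k = v ∨ k = w) →
        ((PlanarRigidity.oneExtension G u v w).deleteEdges {s(none, some i)}).Adj none
          (some k) := by
      intro k hki hk
      rw [SimpleGraph.deleteEdges_adj, oneExtension_adj_none_some]
      exact ⟨hk, by simpa using hki⟩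
    have hr := hG u v huv
    rcases hi with rfl | rfl | rfl
    · exact hr.zeroExtension hwv.symm huv.ne hwu.symm h1 (h2 _ huv.ne' (by simp))
        (h2 _ hwu (by simp))
    · exact hr.zeroExtension hwu.symm huv.ne' hwv.symm h1 (h2 _ huv.ne (by simp))
        (h2 _ hwv (by simp))
    · exact hr.zeroExtension huv.ne hwu hwv h1 (h2 _ hwu.symm (by simp)) (h2 _ hwv.symm (by simp))
  intro i j hij
  cases i with
  | none =>
    cases j with
    | none => exact absurd hij (SimpleGraph.irrefl _)
    | some j => exact hsome j hij
  | some i =>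
    cases j with
    | none =>
      rw [Sym2.eq_swap]
      exact hsome i hij.symm
    | some j =>
      rw [oneExtension_adj_some_some] at hij
      have h2 : ∀ k, (k = u ∨ k = v ∨ k = w) →
          ((PlanarRigidity.oneExtension G u v w).deleteEdges {s(some i, some j)}).Adj none
            (some k) := by
        intro k hk
        rw [SimpleGraph.deleteEdges_adj, oneExtension_adj_none_some]
        exact ⟨hk, by simp⟩
      refine (hG i j hij.1).oneExtension huv.ne hwu hwv (fun k l hkl hne => ?_) (h2 u (by simp))
        (h2 v (by simp)) (h2 w (by simp))
      rw [SimpleGraph.deleteEdges_adj] at hkl ⊢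
      refine ⟨oneExtension_adj_some_some.2 ⟨hkl.1, hne⟩, ?_⟩
      simpa using hkl.2

end Extensions

/-! ### Biopen relations and the induction. -/

section BiopenRelations

variable {V : Type u}

/-- A relation between configurations is biopen if both of its projections are open maps. -/
structure IsBiopen (R : (V → Plane) → (V → Plane) → Prop) : Prop where
  right : ∀ {p q}, R p q → ∀ {N}, N ∈ 𝓝 q → ∀ᶠ p' in 𝓝 p, ∃ q' ∈ N, R p' q'
  left : ∀ {p q}, R p q → ∀ {N}, N ∈ 𝓝 p → ∀ᶠ q' in 𝓝 q, ∃ p' ∈ N, R p' q'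

/-- A biopen relation satisfies a closed condition if it does so on a dense open set. -/
theorem IsBiopen.of_dense {R : (V → Plane) → (V → Plane) → Prop} (hR : IsBiopen R)
    {O : Set (V → Plane)} (hO : IsOpen O) (hd : Dense O) {C : (V → Plane) × (V → Plane) → Prop}
    (hC : IsClosed {r | C r}) (h : ∀ p q, p ∈ O → q ∈ O → R p q → C (p, q)) {p q : V → Plane}
    (hpq : R p q) : C (p, q) := by
  by_contra hn
  have hmem : {r | C r}ᶜ ∈ 𝓝 (p, q) := hC.isOpen_compl.mem_nhds hn
  rw [nhds_prod_eq, mem_prod_iff] at hmem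
  obtain ⟨M, hM, N, hN, hMN⟩ := hmem
  -- The left point is moved into `O` first, then the right one; openness of `O` keeps the left
  -- point inside during the second move.
  obtain ⟨p₁, ⟨hp₁M, q₁, hq₁, hpq₁⟩, hp₁O⟩ :=
    mem_closure_iff_nhds.1 (hd p) _
      (inter_mem (interior_mem_nhds.2 hM) (hR.right hpq (interior_mem_nhds.2 hN)))
  obtain ⟨q₂, ⟨hq₂N, p₂, hp₂, hpq₂⟩, hq₂O⟩ :=
    mem_closure_iff_nhds.1 (hd q₁) _ (inter_mem (isOpen_interior.mem_nhds hq₁)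
      (hR.left hpq₁ (inter_mem (isOpen_interior.mem_nhds hp₁M) (hO.mem_nhds hp₁O))))
  exact hMN (Set.mk_mem_prod (interior_subset hp₂.1) (interior_subset hq₂N))
    (h p₂ q₂ hp₂.2 hq₂O hpq₂)

/-- The restriction to `V` of a relation between configurations of `Option V`. -/
def restrictRel (R : (Option V → Plane) → (Option V → Plane) → Prop) (p q : V → Plane) : Prop :=
  ∃ y z : Plane, R (fun i => i.elim y p) (fun i => i.elim z q)

theorem eq_elim (p : Option V → Plane) : p = fun i => i.elim (p none) fun j => p (some j) := by
  funext i
  cases i <;> rfl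

theorem continuous_elim : Continuous fun r : Plane × (V → Plane) =>
    (fun i => i.elim r.1 r.2 : Option V → Plane) := by
  refine continuous_pi fun i => ?_
  cases i with
  | none => exact continuous_fst
  | some i => exact (continuous_apply i).comp continuous_snd

/-- A motion of the old vertices is lifted by holding the new vertex still; the response is then
restricted. -/
theorem IsBiopen.restrictRel {R : (Option V → Plane) → (Option V → Plane) → Prop}
    (hR : IsBiopen R) : IsBiopen (restrictRel R) := by
  have hres : Continuous fun (p : Option V → Plane) (i : V) => p (some i) :=
    continuous_pi fun i => continuous_apply _
  have hext : ∀ y : Plane, Continuous fun p : V → Plane =>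
      (fun i => i.elim y p : Option V → Plane) := fun y =>
    continuous_elim.comp (continuous_const.prodMk continuous_id)
  constructor
  · rintro p q ⟨y, z, h⟩ N hN
    have hN' := hres.continuousAt (x := fun i => i.elim z q) hN
    filter_upwards [(hext y).continuousAt.eventually (hR.right h hN')] with p' hp'
    obtain ⟨q', hq', hR'⟩ := hp'
    exact ⟨_, hq', y, q' none, eq_elim q' ▸ hR'⟩
  · rintro p q ⟨y, z, h⟩ N hN
    have hN' := hres.continuousAt (x := fun i => i.elim y p) hN
    filter_upwards [(hext z).continuousAt.eventually (hR.left h hN')] with q' hq'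
    obtain ⟨p', hp', hR'⟩ := hq'
    exact ⟨_, hp', p' none, z, eq_elim p' ▸ hR'⟩

theorem isClosed_norm_sq_eq (i j : V) :
    IsClosed {r : (V → Plane) × (V → Plane) | ‖r.1 i - r.1 j‖ ^ 2 = ‖r.2 i - r.2 j‖ ^ 2} :=
  isClosed_eq (by fun_prop) (by fun_prop)

/-- Every biopen relation that preserves the edge lengths of `G` preserves all distances. -/
def BiopenRigid (G : SimpleGraph V) : Prop :=
  ∀ R : (V → Plane) → (V → Plane) → Prop, IsBiopen R →
    (∀ p q, R p q → ∀ i j, G.Adj i j → ‖p i - p j‖ ^ 2 = ‖q i - q j‖ ^ 2) →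
      ∀ p q, R p q → ∀ i j, ‖p i - p j‖ ^ 2 = ‖q i - q j‖ ^ 2

theorem biopenRigid_top : BiopenRigid (⊤ : SimpleGraph V) := by
  intro R _ h p q hpq i j
  by_cases hij : i = j
  · simp [hij]
  · exact h p q hpq i j hij

theorem BiopenRigid.mono {G H : SimpleGraph V} (hG : BiopenRigid G) (hle : G ≤ H) :
    BiopenRigid H :=
  fun R hR h => hG R hR fun p q hpq i j hij => h p q hpq i j (hle hij)

theorem BiopenRigid.iso {W : Type u} {G : SimpleGraph V} {H : SimpleGraph W}
    (hG : BiopenRigid G) (e : G ≃g H) : BiopenRigid H := by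
  intro R hR h p q hpq i j
  have hc : Continuous fun p : V → Plane => p ∘ e.symm :=
    continuous_pi fun i => continuous_apply _
  have hc' : Continuous fun p : W → Plane => p ∘ e := continuous_pi fun i => continuous_apply _
  have he : ∀ p : W → Plane, (p ∘ e) ∘ e.symm = p := fun p => by funext i; simp
  have he' : ∀ p : V → Plane, (p ∘ e.symm) ∘ e = p := fun p => by funext i; simp
  have key := hG (fun p q => R (p ∘ e.symm) (q ∘ e.symm)) ⟨?_, ?_⟩ ?_ (p ∘ e) (q ∘ e)
    (by rwa [he, he]) (e.symm i) (e.symm j)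
  · simpa using key
  · intro p q hpq N hN
    have hN' : (fun p : W → Plane => p ∘ e) ⁻¹' N ∈ 𝓝 (q ∘ e.symm) :=
      hc'.continuousAt (by rwa [he'])
    filter_upwards [hc.continuousAt.eventually (hR.right hpq hN')] with p' hp'
    obtain ⟨q', hq', hR'⟩ := hp'
    exact ⟨_, hq', by rwa [he]⟩
  · intro p q hpq N hN
    have hN' : (fun p : W → Plane => p ∘ e) ⁻¹' N ∈ 𝓝 (p ∘ e.symm) :=
      hc'.continuousAt (by rwa [he'])
    filter_upwards [hc.continuousAt.eventually (hR.left hpq hN')] with q' hq'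
    obtain ⟨p', hp', hR'⟩ := hq'
    exact ⟨_, hp', by rwa [he]⟩
  · intro p q hpq i j hij
    simpa using h _ _ hpq (e i) (e j) (e.map_adj_iff.2 hij)

/-- Distances to a noncollinear triple determine inner products by `cross_sq_mul_inner`, hence
mutual distances. -/
theorem norm_sq_sub_eq_of_cross_ne_zero {u v w z i u' v' w' z' i' : Plane}
    (hne : cross (u - w) (v - w) ≠ 0)
    (huv : ‖u - v‖ ^ 2 = ‖u' - v'‖ ^ 2) (huw : ‖u - w‖ ^ 2 = ‖u' - w'‖ ^ 2)
    (hvw : ‖v - w‖ ^ 2 = ‖v' - w'‖ ^ 2) (hzu : ‖z - u‖ ^ 2 = ‖z' - u'‖ ^ 2)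
    (hzv : ‖z - v‖ ^ 2 = ‖z' - v'‖ ^ 2) (hzw : ‖z - w‖ ^ 2 = ‖z' - w'‖ ^ 2)
    (hiu : ‖i - u‖ ^ 2 = ‖i' - u'‖ ^ 2) (hiv : ‖i - v‖ ^ 2 = ‖i' - v'‖ ^ 2)
    (hiw : ‖i - w‖ ^ 2 = ‖i' - w'‖ ^ 2) : ‖z - i‖ ^ 2 = ‖z' - i'‖ ^ 2 := by
  have key : cross (u - w) (v - w) ^ 2 * inner ℝ (z - w) (i - w)
      = cross (u - w) (v - w) ^ 2 * inner ℝ (z' - w') (i' - w') := by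
    have h : cross (u - w) (v - w) ^ 2 = cross (u' - w') (v' - w') ^ 2 := by
      simp only [cross_sq, inner_sub_eq_norm_sq, huv, huw, hvw, sub_self, norm_zero]
    rw [cross_sq_mul_inner, h, cross_sq_mul_inner]
    simp only [inner_sub_eq_norm_sq, huv, huw, hvw, hzu, hzv, hzw, hiu, hiv, hiw, sub_self,
      norm_zero]
  have h := mul_left_cancel₀ (pow_ne_zero 2 hne) key
  rw [inner_sub_eq_norm_sq, inner_sub_eq_norm_sq, hzw, hiw] at h
  linarith

/-- A `1`-extension on an edge `uv` preserves biopen rigidity if `G - uv` is rigid. -/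
theorem BiopenRigid.oneExtension [Finite V] {G : SimpleGraph V} (hG : BiopenRigid G) {u v w : V}
    (huv : G.Adj u v) (hwu : w ≠ u) (hwv : w ≠ v)
    (hrig : GenericallyRigid (G.deleteEdges {s(u, v)})) :
    BiopenRigid (oneExtension G u v w) := by
  have := Fintype.ofFinite V
  intro R hR h
  have hRV := hR.restrictRel
  obtain ⟨a, b, hab, hex⟩ := hrig
  have hTo := isOpen_setOf_cross_ne_zero u v w
  have hTd := dense_setOf_cross_ne_zero huv.ne hwu hwv
  have hPo := isOpen_setOf_pinnedMap_injective (G.deleteEdges {s(u, v)}) a b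
  have hPd := dense_setOf_pinnedMap_injective hex
  have hH : ∀ p q, restrictRel R p q → ∀ i j, (G.deleteEdges {s(u, v)}).Adj i j →
      ‖p i - p j‖ ^ 2 = ‖q i - q j‖ ^ 2 := by
    rintro p q ⟨y, z, hpq⟩ i j hij
    rw [SimpleGraph.deleteEdges_adj] at hij
    exact h _ _ hpq (some i) (some j) (oneExtension_adj_some_some.2 hij)
  have hedge : ∀ p q, restrictRel R p q → ‖p u - p v‖ ^ 2 = ‖q u - q v‖ ^ 2 := by
    intro p q hpq
    refine hRV.of_dense (hTo.inter hPo) (hTd.inter_of_isOpen_left hPd hTo)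
      (isClosed_norm_sq_eq u v) ?_ hpq
    rintro p q ⟨hp, -⟩ ⟨-, hq⟩ ⟨y, z, hpq⟩
    refine norm_sq_eq_of_eventually_exists (z₀ := y) (a := ‖q u - q w‖ ^ 2) (b := ‖q v - q w‖ ^ 2)
      hp ?_
    have hres : Continuous fun (p : Option V → Plane) (i : V) => p (some i) :=
      continuous_pi fun i => continuous_apply _
    have hq0 : Tendsto (fun (p : Option V → Plane) (i : V) => p (some i))
        (𝓝 fun i => i.elim z q) (𝓝 q) := hres.tendsto fun i => i.elim z q
    have hN := hq0.eventually (eventually_norm_sq_eq_of_pinnedMap_injective hab hq)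
    have hc : Continuous fun y : Plane => (fun i => i.elim y p : Option V → Plane) :=
      continuous_elim.comp (continuous_id.prodMk continuous_const)
    -- Only the new vertex moves on the left. The old part of the response keeps the lengths of `G -
    -- uv` and stays near `q`, so it keeps all distances of `q`.
    filter_upwards [hc.continuousAt.eventually (hR.right hpq hN)] with y' hy'
    obtain ⟨q', hq', hR'⟩ := hy'
    have hRq : restrictRel R p fun i => q' (some i) := by
      refine ⟨y', q' none, ?_⟩
      rwa [← eq_elim]
    have hq'' : ∀ i j, ‖q' (some i) - q' (some j)‖ ^ 2 = ‖q i - q j‖ ^ 2 :=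
      hq' fun i j hij => (hH p _ hRq i j hij).symm.trans (hH p q ⟨y, z, hpq⟩ i j hij)
    refine ⟨q' none, q' (some u), q' (some v), q' (some w), ?_, ?_, ?_, hq'' u w, hq'' v w,
      hq'' u v⟩
    · exact h _ _ hR' none (some u) (oneExtension_adj_none_some.2 (by simp))
    · exact h _ _ hR' none (some v) (oneExtension_adj_none_some.2 (by simp))
    · exact h _ _ hR' none (some w) (oneExtension_adj_none_some.2 (by simp))
  have hV : ∀ p q, restrictRel R p q → ∀ i j, ‖p i - p j‖ ^ 2 = ‖q i - q j‖ ^ 2 := by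
    refine hG _ hRV fun p q hpq i j hij => ?_
    by_cases hs : s(i, j) = s(u, v)
    · rcases Sym2.eq_iff.1 hs with ⟨rfl, rfl⟩ | ⟨rfl, rfl⟩
      · exact hedge p q hpq
      · rw [norm_sub_rev, hedge p q hpq, norm_sub_rev]
    · exact hH p q hpq i j (SimpleGraph.deleteEdges_adj.2 ⟨hij, hs⟩)
  have hRV' : ∀ p q, R p q → restrictRel R (fun i => p (some i)) fun i => q (some i) := by
    intro p q hpq
    exact ⟨p none, q none, by rwa [← eq_elim, ← eq_elim]⟩
  have hz : ∀ p q, R p q → ∀ i, ‖p none - p (some i)‖ ^ 2 = ‖q none - q (some i)‖ ^ 2 := by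
    intro p q hpq i
    have hTo' := isOpen_setOf_cross_ne_zero (some u) (some v) (some w)
    have hTd' := dense_setOf_cross_ne_zero (u := some u) (v := some v) (w := some w)
      (by simpa using huv.ne) (by simpa using hwu) (by simpa using hwv)
    refine hR.of_dense hTo' hTd' (isClosed_norm_sq_eq none (some i)) ?_ hpq
    intro p q hp _ hpq
    have hd := hV _ _ (hRV' p q hpq)
    exact norm_sq_sub_eq_of_cross_ne_zero hp (hd u v) (hd u w) (hd v w)
      (h _ _ hpq none (some u) (oneExtension_adj_none_some.2 (by simp)))
      (h _ _ hpq none (some v) (oneExtension_adj_none_some.2 (by simp)))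
      (h _ _ hpq none (some w) (oneExtension_adj_none_some.2 (by simp)))
      (hd i u) (hd i v) (hd i w)
  intro p q hpq i j
  cases i with
  | none =>
    cases j with
    | none => simp
    | some j => exact hz p q hpq j
  | some i =>
    cases j with
    | none => rw [norm_sub_rev, hz p q hpq i, norm_sub_rev]
    | some j => exact hV _ _ (hRV' p q hpq) i j

/-- The properties are proved jointly: the `1`-extension step for `BiopenRigid` uses redundant
rigidity, whose edge-addition step uses an existing edge. -/
theorem BuiltFromK4.biopenRigid {V : Type u} {G : SimpleGraph V} (hG : BuiltFromK4 G) :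
    Finite V ∧ (∃ i j, G.Adj i j) ∧ RedundantlyRigid G ∧ BiopenRigid G := by
  induction hG with
  | base hV =>
    have hfin := Nat.finite_of_card_ne_zero (hV ▸ four_ne_zero)
    have hnt : Nontrivial _ := Finite.one_lt_card_iff_nontrivial.1 (by rw [hV]; norm_num)
    exact ⟨hfin, hnt.exists_pair_ne, redundantlyRigid_top hV, biopenRigid_top⟩
  | edgeAddition _ hab hn ih =>
    obtain ⟨hfin, ⟨i, j, hij⟩, hred, hrig⟩ := ih
    exact ⟨hfin, ⟨i, j, Or.inl hij⟩, hred.mono ⟨i, j, hij⟩ le_sup_left, hrig.mono le_sup_left⟩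
  | @oneExt V G h a b w hab hwa hwb ih =>
    obtain ⟨hfin, -, hred, hrig⟩ := ih
    exact ⟨inferInstance, ⟨none, some a, oneExtension_adj_none_some.2 (by simp)⟩,
      hred.oneExtension hab hwa hwb, hrig.oneExtension hab hwa hwb (hred a b hab)⟩
  | iso _ e ih =>
    obtain ⟨hfin, ⟨i, j, hij⟩, hred, hrig⟩ := ih
    exact ⟨Finite.of_equiv _ e.toEquiv, ⟨e i, e j, e.map_adj_iff.2 hij⟩, hred.iso e, hrig.iso e⟩

end BiopenRelations

/-! ### From equal distances to a congruence. -/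

section Congruence

variable {V : Type u}

/-- Equal Gram matrices give equal norms of linear combinations, so `x i ↦ y i` is a well-defined
isometry on the span; finite dimension lets it extend. -/
theorem exists_linearIsometry_of_inner_eq {ι E : Type*} [NormedAddCommGroup E]
    [InnerProductSpace ℝ E] [FiniteDimensional ℝ E] {x y : ι → E}
    (h : ∀ i j, inner ℝ (x i) (x j) = inner ℝ (y i) (y j)) :
    ∃ L : E →ₗᵢ[ℝ] E, ∀ i, L (x i) = y i := by
  set X := Finsupp.linearCombination ℝ x with hX
  set Y := Finsupp.linearCombination ℝ y with hY
  have hnorm : ∀ c, ‖X c‖ = ‖Y c‖ := by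
    intro c
    rw [← sq_eq_sq₀ (norm_nonneg _) (norm_nonneg _), ← real_inner_self_eq_norm_sq,
      ← real_inner_self_eq_norm_sq]
    simp only [hX, hY, Finsupp.linearCombination_apply, Finsupp.sum, sum_inner, inner_sum,
      real_inner_smul_left, real_inner_smul_right, h]
  have hker : LinearMap.ker X ≤ LinearMap.ker Y := by
    intro c hc
    rw [LinearMap.mem_ker] at hc ⊢
    rw [← norm_eq_zero, ← hnorm, hc, norm_zero]
  set T : LinearMap.range X →ₗ[ℝ] E :=
    (LinearMap.ker X).liftQ Y hker ∘ₗ X.quotKerEquivRange.symm.toLinearMap with hT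
  have hTX : ∀ c, T ⟨X c, LinearMap.mem_range_self X c⟩ = Y c := by
    intro c
    have : X.quotKerEquivRange.symm ⟨X c, LinearMap.mem_range_self X c⟩
        = Submodule.Quotient.mk c := by
      rw [LinearEquiv.symm_apply_eq]
      rfl
    simp [hT, this]
  refine ⟨LinearIsometry.extend ⟨T, ?_⟩, fun i => ?_⟩
  · rintro ⟨_, c, rfl⟩
    rw [hTX, ← hnorm]
    rfl
  · have h1 : X (Finsupp.single i 1) = x i := by simp [hX]
    have h2 : Y (Finsupp.single i 1) = y i := by simp [hY]
    have h3 := LinearIsometry.extend_apply ⟨T, by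
      rintro ⟨_, c, rfl⟩
      rw [hTX, ← hnorm]
      rfl⟩ ⟨X (Finsupp.single i 1), LinearMap.mem_range_self X _⟩
    rw [← h1, ← h2, ← hTX]
    exact h3

theorem isCongruent_of_norm_sq_eq {p q : V → Plane}
    (h : ∀ i j, ‖p i - p j‖ ^ 2 = ‖q i - q j‖ ^ 2) : IsCongruent p q := by
  rcases isEmpty_or_nonempty V with hV | ⟨⟨o⟩⟩
  · exact ⟨IsometryEquiv.refl _, fun v => hV.elim v⟩
  obtain ⟨L, hL⟩ := exists_linearIsometry_of_inner_eq (x := fun i => p i - p o)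
    (y := fun i => q i - q o) fun i j => by
      simp only [inner_sub_eq_norm_sq, h]
  refine ⟨((IsometryEquiv.subRight (p o)).trans
    (L.toLinearIsometryEquiv rfl).toIsometryEquiv).trans (IsometryEquiv.addRight (q o)),
    fun v => ?_⟩
  have := hL v
  simp [this]

end Congruence

end PlanarRigidity

theorem mainTheorem5 {V : Type u} [Fintype V] (G : SimpleGraph V)
    (hG : PlanarRigidity.BuiltFromK4 G) : PlanarRigidity.GloballyRigid G := by
  open PlanarRigidity in
  intro p q hp hq hpq
  refine isCongruent_of_norm_sq_eq (hG.biopenRigid.2.2.2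
    (fun p q => IsGenericEmbedding G p ∧ IsGenericEmbedding G q ∧
      edgeFunction G p = edgeFunction G q) ⟨?_, ?_⟩
    (fun p q h => (edgeFunction_eq_iff G p q).1 h.2.2) p q ⟨hp, hq, hpq⟩)
  -- Genericity is open on both sides, so the lifted configurations stay in the relation.
  · rintro p q ⟨hp, hq, hpq⟩ N hN
    filter_upwards [eventually_isGenericEmbedding hp, eventually_exists_edgeFunction_eq hq hpq
      (Filter.inter_mem hN (eventually_isGenericEmbedding hq))] with p' hp' hex
    obtain ⟨q', ⟨hq'N, hq'⟩, h⟩ := hex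
    exact ⟨q', hq'N, hp', hq', h⟩
  · rintro p q ⟨hp, hq, hpq⟩ N hN
    filter_upwards [eventually_isGenericEmbedding hq, eventually_exists_edgeFunction_eq hp hpq.symm
      (Filter.inter_mem hN (eventually_isGenericEmbedding hp))] with q' hq' hex
    obtain ⟨p', ⟨hp'N, hp'⟩, h⟩ := hex
    exact ⟨p', hp'N, hp', hq', h.symm⟩
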